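/- Let $d\ge 0$. Let $\mathcal P_2(\mathbb R^d)$ be the set of Borel probability measures on $\mathbb R^d$ with finite second moment, with the 2-Wasserstein distance $W_2(\mu,\nu)=\big(\inf_{\pi}\int \|x-y\|^2\,d\pi(x,y)\big)^{1/2}$, the infimum being over all couplings $\pi$ of $\mu$ and $\nu$. The Bures–Wasserstein space is the set of nondegenerate Gaussian measures $\mathcal N(m,\Sigma)$ ($m\in\mathbb R^d$, $\Sigma\in\mathbb R^{d\times d}$ symmetric positive definite) with the distance $W_2$, and $\mathrm{IG}=\{\mathcal N(m,\epsilon I_d): m\in\mathbb R^d,\ \epsilon>0\}$ is the set of isotropic Gaussian measures. In a metric space $(X,\rho)$, a geodesic from $x$ to $y$ is a curve $\gamma:[0,1]\to X$ with $\gamma(0)=x$, $\gamma(1)=y$ and $\rho(\gamma(s),\gamma(t))=|s-t|\,\rho(x,y)$ for all $s,t\in[0,1]$; a set $C\subseteq X$ is geodesically convex if any two points of $C$ are joined by a geodesic of $X$ and every geodesic of $X$ joining two points of $C$ is contained in $C$. Then: 1. $\mathrm{IG}$ is a geodesically convex subset of the Bures–Wasserstein space. 2. The Bures–Wasserstein space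 is geodesically convex in $(\mathcal P_2(\mathbb R^d),W_2)$. 3. For all $m_p,m_q\in\mathbb R^d$ and $\epsilon_p,\epsilon_q>0$ there is exactly one geodesic in $(\mathcal P_2(\mathbb R^d),W_2)$ from $\mathcal N(m_p,\epsilon_p I_d)$ to $\mathcal N(m_q,\epsilon_q I_d)$, namely $$t\mapsto \mathcal N\Big((1-t)m_p+t\,m_q,\ \big((1-t)+t\sqrt{\epsilon_q/\epsilon_p}\big)^2\epsilon_p\, I_d\Big),\qquad t\in[0,1].$$ -/

import Mathlib

open MeasureTheory ProbabilityTheory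
open scoped ENNReal

noncomputable section

/-- A (constant-speed, minimizing) geodesic from `x` to `y`, parametrized by `[0, 1]`, for the
distance `dist` on `X`. -/
def IsGeodesic {X : Type*} (dist : X → X → ℝ) (x y : X) (γ : unitInterval → X) : Prop :=
  γ 0 = x ∧ γ 1 = y ∧ ∀ s t : unitInterval, dist (γ s) (γ t) = |(s : ℝ) - (t : ℝ)| * dist x y

/-- `C` is geodesically convex in `(X, dist)`: any two points of `C` are joined by a geodesic
of `X`, and every geodesic of `X` between two points of `C` stays in `C`. -/
def GeodesicallyConvex {X : Type*} (dist : X → X → ℝ) (C : Set X) : Prop :=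
  ∀ x ∈ C, ∀ y ∈ C,
    (∃ γ : unitInterval → X, IsGeodesic dist x y γ) ∧
      ∀ γ : unitInterval → X, IsGeodesic dist x y γ → ∀ t, γ t ∈ C

/-- The set `𝒫₂(ℝᵈ)` of Borel probability measures on `ℝᵈ` with finite second moment. -/
def P2 (d : ℕ) : Type :=
  {μ : Measure (EuclideanSpace ℝ (Fin d)) // IsProbabilityMeasure μ ∧ MemLp id 2 μ}

/-- The couplings (transport plans) of two measures on `ℝᵈ`. -/
def couplings {d : ℕ} (μ ν : Measure (EuclideanSpace ℝ (Fin d))) :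
    Set (Measure (EuclideanSpace ℝ (Fin d) × EuclideanSpace ℝ (Fin d))) :=
  {π | π.fst = μ ∧ π.snd = ν}

/-- The quadratic transport cost `inf_π ∫ ‖x - y‖² dπ(x, y)` over all couplings `π`. It is finite
for measures in `𝒫₂(ℝᵈ)`. -/
def transportCost {d : ℕ} (μ ν : Measure (EuclideanSpace ℝ (Fin d))) : ℝ≥0∞ :=
  ⨅ π ∈ couplings μ ν, ∫⁻ z, edist z.1 z.2 ^ 2 ∂π

/-- The 2-Wasserstein distance on `𝒫₂(ℝᵈ)`. -/
def W2 {d : ℕ} (μ ν : P2 d) : ℝ :=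
  Real.sqrt (transportCost μ.1 ν.1).toReal

/-- The Gaussian measure `N(m, S)` as an element of `𝒫₂(ℝᵈ)`. -/
def gaussianP2 {d : ℕ} (m : EuclideanSpace ℝ (Fin d)) (S : Matrix (Fin d) (Fin d) ℝ) : P2 d :=
  ⟨multivariateGaussian m S, inferInstance, IsGaussian.memLp_two_id⟩

/-- The nondegenerate Gaussian measures on `ℝᵈ`. -/
def nondegenerateGaussians (d : ℕ) : Set (P2 d) :=
  {μ | ∃ (m : EuclideanSpace ℝ (Fin d)) (S : Matrix (Fin d) (Fin d) ℝ),
    S.PosDef ∧ μ = gaussianP2 m S}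

/-- The isotropic Gaussian measure `N(m, ε I)`. -/
def isotropicGaussian {d : ℕ} (m : EuclideanSpace ℝ (Fin d)) (ε : ℝ) : P2 d :=
  gaussianP2 m (ε • (1 : Matrix (Fin d) (Fin d) ℝ))

/-- The set `IG` of isotropic Gaussian measures on `ℝᵈ`. -/
def isotropicGaussians (d : ℕ) : Set (P2 d) :=
  {μ | ∃ (m : EuclideanSpace ℝ (Fin d)) (ε : ℝ), 0 < ε ∧ μ = isotropicGaussian m ε}

/-- The points of the Bures–Wasserstein space: the nondegenerate Gaussian measures. -/
abbrev BuresWasserstein (d : ℕ) : Type := nondegenerateGaussians d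

/-- The Bures–Wasserstein distance: the restriction of `W2` to nondegenerate Gaussians. -/
def BW {d : ℕ} (μ ν : BuresWasserstein d) : ℝ := W2 μ.1 ν.1

end

/-! ### Couplings, the distance through near-optimal plans, and a criterion for being a
push-forward. -/

section Couplings

variable {d : ℕ}

/-! Two nondegenerate Gaussians are related by an affine map `T x = b + M x` with `M` positive
definite. For such `T`, completing the square splits `‖x - y‖ ^ 2` into a function of `x`, a
function of `y` and the gap `⟪y - T x, M⁻¹ (y - T x)⟫ ≥ 0`, which vanishes only on the graph of `T`
(`norm_sub_sq_eq_potentials`). The first two integrate to constants over all couplings, so `T` is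
optimal (`W2_affineMap_sq`), and the maps `(1 - s) x + s T x` trace a geodesic (`W2_displacement`).

Uniqueness (`eq_displacement_of_W2_eq`): let `ρ` lie at fraction `s` between `μ` and its image. Add
the costs of near-optimal plans for the two halves with weights `1 - s` and `s`. The potentials
evaluated at `ρ` add up to a constant, so both gaps are arbitrarily small, and `ρ` must be the image
of `μ` under the interpolated map. Neither existence of optimal plans nor gluing of plans is needed.

The source of the geodesic may be any measure in `P2 d`; Gaussians enter only because affine maps
preserve them. -/

instance P2.isProbabilityMeasure (μ : P2 d) : IsProbabilityMeasure μ.1 := μ.2.1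

lemma P2.memLp (μ : P2 d) : MemLp id 2 μ.1 := μ.2.2

lemma couplings.isProbabilityMeasure {μ ν : P2 d}
    {π : Measure (EuclideanSpace ℝ (Fin d) × EuclideanSpace ℝ (Fin d))}
    (h : π ∈ couplings μ.1 ν.1) : IsProbabilityMeasure π := by
  have h1 : IsProbabilityMeasure (π.map Prod.fst) := by
    have := h.1
    rw [Measure.fst] at this
    rw [this]; infer_instance
  exact Measure.isProbabilityMeasure_of_map Prod.fst

lemma couplings.measurePreserving_fst {μ ν : P2 d}
    {π : Measure (EuclideanSpace ℝ (Fin d) × EuclideanSpace ℝ (Fin d))}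
    (h : π ∈ couplings μ.1 ν.1) : MeasurePreserving Prod.fst π μ.1 :=
  ⟨measurable_fst, h.1⟩

lemma couplings.measurePreserving_snd {μ ν : P2 d}
    {π : Measure (EuclideanSpace ℝ (Fin d) × EuclideanSpace ℝ (Fin d))}
    (h : π ∈ couplings μ.1 ν.1) : MeasurePreserving Prod.snd π ν.1 :=
  ⟨measurable_snd, h.2⟩

lemma couplings.memLp_fst {μ ν : P2 d}
    {π : Measure (EuclideanSpace ℝ (Fin d) × EuclideanSpace ℝ (Fin d))}
    (h : π ∈ couplings μ.1 ν.1) : MemLp Prod.fst 2 π :=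
  μ.memLp.comp_measurePreserving (couplings.measurePreserving_fst h)

lemma couplings.memLp_snd {μ ν : P2 d}
    {π : Measure (EuclideanSpace ℝ (Fin d) × EuclideanSpace ℝ (Fin d))}
    (h : π ∈ couplings μ.1 ν.1) : MemLp Prod.snd 2 π :=
  ν.memLp.comp_measurePreserving (couplings.measurePreserving_snd h)

lemma couplings.integrable_norm_sub_sq {μ ν : P2 d}
    {π : Measure (EuclideanSpace ℝ (Fin d) × EuclideanSpace ℝ (Fin d))}
    (h : π ∈ couplings μ.1 ν.1) : Integrable (fun z ↦ ‖z.1 - z.2‖ ^ 2) π :=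
  ((couplings.memLp_fst h).sub (couplings.memLp_snd h)).norm.integrable_sq

lemma couplings.lintegral_edist_sq {μ ν : P2 d}
    {π : Measure (EuclideanSpace ℝ (Fin d) × EuclideanSpace ℝ (Fin d))}
    (h : π ∈ couplings μ.1 ν.1) :
    ∫⁻ z, edist z.1 z.2 ^ 2 ∂π = ENNReal.ofReal (∫ z, ‖z.1 - z.2‖ ^ 2 ∂π) := by
  rw [ofReal_integral_eq_lintegral_ofReal (couplings.integrable_norm_sub_sq h)
    (Filter.Eventually.of_forall fun z ↦ by positivity)]
  refine lintegral_congr fun z ↦ ?_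
  rw [edist_dist, dist_eq_norm, ENNReal.ofReal_pow (norm_nonneg _)]

lemma prod_mem_couplings (μ ν : P2 d) : μ.1.prod ν.1 ∈ couplings μ.1 ν.1 := by
  constructor <;> simp

lemma transportCost_ne_top (μ ν : P2 d) : transportCost μ.1 ν.1 ≠ ∞ := by
  refine ne_top_of_le_ne_top ?_ (iInf₂_le _ (prod_mem_couplings μ ν))
  rw [couplings.lintegral_edist_sq (prod_mem_couplings μ ν)]
  exact ENNReal.ofReal_ne_top

lemma W2_nonneg (μ ν : P2 d) : 0 ≤ W2 μ ν := Real.sqrt_nonneg _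

lemma W2_sq (μ ν : P2 d) : W2 μ ν ^ 2 = (transportCost μ.1 ν.1).toReal :=
  Real.sq_sqrt ENNReal.toReal_nonneg

lemma W2_sq_le {μ ν : P2 d}
    {π : Measure (EuclideanSpace ℝ (Fin d) × EuclideanSpace ℝ (Fin d))}
    (h : π ∈ couplings μ.1 ν.1) : W2 μ ν ^ 2 ≤ ∫ z, ‖z.1 - z.2‖ ^ 2 ∂π := by
  rw [W2_sq]
  refine ENNReal.toReal_le_of_le_ofReal (integral_nonneg fun z ↦ by positivity) ?_
  rw [← couplings.lintegral_edist_sq h]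
  exact iInf₂_le _ h

lemma exists_coupling_lt (μ ν : P2 d) {ε : ℝ} (hε : 0 < ε) :
    ∃ π ∈ couplings μ.1 ν.1, ∫ z, ‖z.1 - z.2‖ ^ 2 ∂π < W2 μ ν ^ 2 + ε := by
  have h : transportCost μ.1 ν.1 < ENNReal.ofReal (W2 μ ν ^ 2 + ε) := by
    rw [ENNReal.lt_ofReal_iff_toReal_lt (transportCost_ne_top μ ν), W2_sq]
    linarith
  obtain ⟨π, hπ, hlt⟩ : ∃ π, ∃ _ : π ∈ couplings μ.1 ν.1,
      ∫⁻ z, edist z.1 z.2 ^ 2 ∂π < ENNReal.ofReal (W2 μ ν ^ 2 + ε) := by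
    simpa only [transportCost, iInf_lt_iff] using h
  refine ⟨π, hπ, ?_⟩
  rw [couplings.lintegral_edist_sq hπ] at hlt
  exact (ENNReal.ofReal_lt_ofReal_iff (by positivity)).1 hlt

/-- Since `t ↦ exp (i t)` is 1-Lipschitz, the difference is at most `‖ξ‖` times the mean of `r =
‖z.2 - S z.1‖`; then `r ≤ a + a⁻¹ r ^ 2` brings in the quadratic cost. -/
lemma charFun_sub_le {μ ν : P2 d} {S : EuclideanSpace ℝ (Fin d) → EuclideanSpace ℝ (Fin d)}
    (hS : Measurable S) {π : Measure (EuclideanSpace ℝ (Fin d) × EuclideanSpace ℝ (Fin d))}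
    (h : π ∈ couplings μ.1 ν.1) (hint : Integrable (fun z ↦ ‖z.2 - S z.1‖ ^ 2) π)
    (ξ : EuclideanSpace ℝ (Fin d)) {a : ℝ} (ha : 0 < a) :
    ‖charFun ν.1 ξ - charFun (μ.1.map S) ξ‖ ≤
      ‖ξ‖ * (a + a⁻¹ * ∫ z, ‖z.2 - S z.1‖ ^ 2 ∂π) := by
  have := couplings.isProbabilityMeasure h
  have e1 : charFun ν.1 ξ = ∫ z, Complex.exp (inner ℝ z.2 ξ * Complex.I) ∂π := by
    rw [charFun_apply, ← (couplings.measurePreserving_snd h).map_eq,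
      integral_map measurable_snd.aemeasurable (by fun_prop)]
  have e2 : charFun (μ.1.map S) ξ = ∫ z, Complex.exp (inner ℝ (S z.1) ξ * Complex.I) ∂π := by
    rw [charFun_apply, integral_map hS.aemeasurable (by fun_prop),
      ← (couplings.measurePreserving_fst h).map_eq,
      integral_map measurable_fst.aemeasurable (Measurable.aestronglyMeasurable (by fun_prop))]
  have i1 : Integrable (fun z : EuclideanSpace ℝ (Fin d) × EuclideanSpace ℝ (Fin d) ↦
      Complex.exp (inner ℝ z.2 ξ * Complex.I)) π := by
    refine Integrable.of_bound (Measurable.aestronglyMeasurable (by fun_prop)) 1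
      (.of_forall fun z ↦ ?_)
    rw [Complex.norm_exp_ofReal_mul_I]
  have i2 : Integrable (fun z : EuclideanSpace ℝ (Fin d) × EuclideanSpace ℝ (Fin d) ↦
      Complex.exp (inner ℝ (S z.1) ξ * Complex.I)) π := by
    refine Integrable.of_bound (Measurable.aestronglyMeasurable (by fun_prop)) 1
      (.of_forall fun z ↦ ?_)
    rw [Complex.norm_exp_ofReal_mul_I]
  have e3 : ‖ξ‖ * (a + a⁻¹ * ∫ z, ‖z.2 - S z.1‖ ^ 2 ∂π) =
      ∫ z, ‖ξ‖ * (a + a⁻¹ * ‖z.2 - S z.1‖ ^ 2) ∂π := by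
    rw [integral_const_mul, integral_add (integrable_const _) (hint.const_mul _),
      integral_const_mul]
    simp
  rw [e1, e2, ← integral_sub i1 i2, e3]
  refine norm_integral_le_of_norm_le
    (((integrable_const a).add (hint.const_mul a⁻¹)).const_mul ‖ξ‖) (.of_forall fun z ↦ ?_)
  have e4 : Complex.exp (inner ℝ z.2 ξ * Complex.I) - Complex.exp (inner ℝ (S z.1) ξ * Complex.I)
      = Complex.exp (inner ℝ (S z.1) ξ * Complex.I) *
        (Complex.exp (Complex.I * (inner ℝ (z.2 - S z.1) ξ : ℝ)) - 1) := by
    rw [mul_sub, ← Complex.exp_add, inner_sub_left]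
    push_cast
    ring_nf
  rw [e4, norm_mul, Complex.norm_exp_ofReal_mul_I, one_mul]
  refine Real.norm_exp_I_mul_ofReal_sub_one_le.trans ((norm_inner_le_norm _ _).trans ?_)
  rw [mul_comm]
  gcongr
  generalize ‖z.2 - S z.1‖ = r
  have h2 : 2 * r ≤ a + a⁻¹ * r ^ 2 := by
    have : a + a⁻¹ * r ^ 2 - 2 * r = a⁻¹ * (a - r) ^ 2 := by field_simp; ring
    have : 0 ≤ a⁻¹ * (a - r) ^ 2 := by positivity
    linarith
  have h3 : 0 ≤ a + a⁻¹ * r ^ 2 := by positivity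
  linarith

/-- If `ν` is coupled to `μ` by plans concentrated arbitrarily close to the graph of `S`, then
`ν` is the image of `μ` by `S`. -/
lemma eq_map_of_forall_coupling {μ ν : P2 d}
    {S : EuclideanSpace ℝ (Fin d) → EuclideanSpace ℝ (Fin d)} (hS : Measurable S)
    (h : ∀ ε > 0, ∃ π ∈ couplings μ.1 ν.1, Integrable (fun z ↦ ‖z.2 - S z.1‖ ^ 2) π ∧
      ∫ z, ‖z.2 - S z.1‖ ^ 2 ∂π ≤ ε) :
    ν.1 = μ.1.map S := by
  have : IsProbabilityMeasure (μ.1.map S) := Measure.isProbabilityMeasure_map hS.aemeasurable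
  refine Measure.ext_of_charFun (funext fun ξ ↦ ?_)
  rw [← sub_eq_zero, ← norm_le_zero_iff]
  refine le_of_forall_pos_le_add fun δ hδ ↦ ?_
  -- A cost of at most `a ^ 2` gives the bound `2 a ‖ξ‖ ≤ δ`; the `+ 1` covers `ξ = 0`.
  set a := δ / (2 * (‖ξ‖ + 1)) with ha_def
  have ha : 0 < a := by positivity
  obtain ⟨π, hπ, hint, hle⟩ := h (a ^ 2) (by positivity)
  refine (charFun_sub_le hS hπ hint ξ ha).trans ?_
  calc ‖ξ‖ * (a + a⁻¹ * ∫ z, ‖z.2 - S z.1‖ ^ 2 ∂π)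
      ≤ (‖ξ‖ + 1) * (a + a⁻¹ * a ^ 2) := by gcongr; linarith
    _ = 0 + δ := by
      rw [ha_def]; field_simp; ring

end Couplings

/-! ### Positive definite matrices and the quadratic Kantorovich potentials of an affine map. -/

noncomputable section AffineMaps

variable {d : ℕ}

open scoped MatrixOrder

lemma Matrix.PosDef.sqrt {M : Matrix (Fin d) (Fin d) ℝ} (hM : M.PosDef) :
    (CFC.sqrt M).PosDef := by
  have h0 : (CFC.sqrt M).PosSemidef := Matrix.nonneg_iff_posSemidef.1 (CFC.sqrt_nonneg M)
  rw [h0.posDef_iff_isUnit]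
  refine isUnit_of_mul_isUnit_left (y := CFC.sqrt M) ?_
  rw [CFC.sqrt_mul_sqrt_self M hM.posSemidef.nonneg]
  exact hM.isUnit

lemma Matrix.PosDef.inv_mul_self {M : Matrix (Fin d) (Fin d) ℝ} (hM : M.PosDef) : M⁻¹ * M = 1 :=
  Matrix.nonsing_inv_mul _ ((Matrix.isUnit_iff_isUnit_det _).1 hM.isUnit)

lemma Matrix.PosDef.mul_inv_self {M : Matrix (Fin d) (Fin d) ℝ} (hM : M.PosDef) : M * M⁻¹ = 1 :=
  Matrix.mul_nonsing_inv _ ((Matrix.isUnit_iff_isUnit_det _).1 hM.isUnit)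

/-- The action of a matrix on Euclidean space. -/
abbrev matrixAction (M : Matrix (Fin d) (Fin d) ℝ) :
    EuclideanSpace ℝ (Fin d) →L[ℝ] EuclideanSpace ℝ (Fin d) :=
  Matrix.toEuclideanCLM (𝕜 := ℝ) M

lemma matrixAction_mul (M N : Matrix (Fin d) (Fin d) ℝ) (x : EuclideanSpace ℝ (Fin d)) :
    matrixAction (M * N) x = matrixAction M (matrixAction N x) := by
  simp [matrixAction]

lemma inner_matrixAction_comm {M : Matrix (Fin d) (Fin d) ℝ} (hM : M.IsHermitian)
    (x y : EuclideanSpace ℝ (Fin d)) :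
    inner ℝ (matrixAction M x) y = inner ℝ x (matrixAction M y) := by
  have h : star M = M := hM
  have h2 : ContinuousLinearMap.adjoint (matrixAction M) = matrixAction M := by
    rw [← ContinuousLinearMap.star_eq_adjoint, matrixAction, ← map_star, h]
  conv_lhs => rw [← h2]
  exact ContinuousLinearMap.adjoint_inner_left _ _ _

/-- A positive definite matrix is coercive. -/
lemma Matrix.PosDef.exists_le_inner {M : Matrix (Fin d) (Fin d) ℝ} (hM : M.PosDef) :
    ∃ c > 0, ∀ w : EuclideanSpace ℝ (Fin d), c * ‖w‖ ^ 2 ≤ inner ℝ w (matrixAction M w) := by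
  set R := CFC.sqrt M
  have hR : R.PosDef := hM.sqrt
  -- With `R` the square root of `M`, `⟪w, M w⟫ = ‖R w‖ ^ 2` and `‖w‖ ≤ ‖R⁻¹‖ ‖R w‖`. The `+ 1`
  -- keeps the constant positive when `d = 0`.
  refine ⟨((‖matrixAction R⁻¹‖ + 1) ^ 2)⁻¹, by positivity, fun w ↦ ?_⟩
  have h1 : inner ℝ w (matrixAction M w) = ‖matrixAction R w‖ ^ 2 := by
    rw [← CFC.sqrt_mul_sqrt_self M hM.posSemidef.nonneg, matrixAction_mul,
      ← inner_matrixAction_comm hR.1, real_inner_self_eq_norm_sq]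
  have h2 : ‖w‖ ≤ (‖matrixAction R⁻¹‖ + 1) * ‖matrixAction R w‖ := by
    calc ‖w‖ = ‖matrixAction R⁻¹ (matrixAction R w)‖ := by
          rw [← matrixAction_mul, hR.inv_mul_self]
          simp [matrixAction]
      _ ≤ ‖matrixAction R⁻¹‖ * ‖matrixAction R w‖ := ContinuousLinearMap.le_opNorm _ _
      _ ≤ _ := by gcongr; linarith
  rw [h1, inv_mul_le_iff₀ (by positivity), ← mul_pow]
  gcongr

lemma Matrix.PosDef.inner_nonneg {M : Matrix (Fin d) (Fin d) ℝ} (hM : M.PosDef)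
    (w : EuclideanSpace ℝ (Fin d)) : 0 ≤ inner ℝ w (matrixAction M w) := by
  obtain ⟨c, hc, h⟩ := hM.exists_le_inner
  exact le_trans (by positivity) (h w)

/-- The affine map `x ↦ b + M x`. -/
def affineAction (b : EuclideanSpace ℝ (Fin d)) (M : Matrix (Fin d) (Fin d) ℝ)
    (x : EuclideanSpace ℝ (Fin d)) : EuclideanSpace ℝ (Fin d) :=
  b + matrixAction M x

@[fun_prop]
lemma continuous_affineAction (b : EuclideanSpace ℝ (Fin d)) (M : Matrix (Fin d) (Fin d) ℝ) :
    Continuous (affineAction b M) := by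
  unfold affineAction; fun_prop

@[fun_prop]
lemma measurable_affineAction (b : EuclideanSpace ℝ (Fin d)) (M : Matrix (Fin d) (Fin d) ℝ) :
    Measurable (affineAction b M) := (continuous_affineAction b M).measurable

/-- The Kantorovich potential on the source of the affine map `x ↦ b + M x`. -/
def sourcePotential (b : EuclideanSpace ℝ (Fin d)) (M : Matrix (Fin d) (Fin d) ℝ)
    (x : EuclideanSpace ℝ (Fin d)) : ℝ :=
  ‖x‖ ^ 2 - inner ℝ x (matrixAction M x) - 2 * inner ℝ x b

/-- The Kantorovich potential on the target of the affine map `x ↦ b + M x`. -/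
def targetPotential (b : EuclideanSpace ℝ (Fin d)) (M : Matrix (Fin d) (Fin d) ℝ)
    (y : EuclideanSpace ℝ (Fin d)) : ℝ :=
  ‖y - b‖ ^ 2 - inner ℝ (y - b) (matrixAction M⁻¹ (y - b)) + 2 * inner ℝ (y - b) b + ‖b‖ ^ 2

/-- The amount by which the sum of the two potentials falls short of the cost. -/
def dualityGap (b : EuclideanSpace ℝ (Fin d)) (M : Matrix (Fin d) (Fin d) ℝ)
    (x y : EuclideanSpace ℝ (Fin d)) : ℝ :=
  inner ℝ (y - affineAction b M x) (matrixAction M⁻¹ (y - affineAction b M x))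

lemma dualityGap_affineAction (b : EuclideanSpace ℝ (Fin d)) (M : Matrix (Fin d) (Fin d) ℝ)
    (x : EuclideanSpace ℝ (Fin d)) : dualityGap b M x (affineAction b M x) = 0 := by
  simp [dualityGap]

lemma dualityGap_nonneg {M : Matrix (Fin d) (Fin d) ℝ} (hM : M.PosDef)
    (b x y : EuclideanSpace ℝ (Fin d)) : 0 ≤ dualityGap b M x y :=
  hM.inv.inner_nonneg _

/-- With `w = y - b` the gap is `⟪w, M⁻¹ w⟫ - 2 ⟪x, w⟫ + ⟪x, M x⟫`, whose cross term is exactly the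
non-separable part of `‖x - y‖ ^ 2`. -/
lemma norm_sub_sq_eq_potentials {M : Matrix (Fin d) (Fin d) ℝ} (hM : M.PosDef)
    (b x y : EuclideanSpace ℝ (Fin d)) :
    ‖x - y‖ ^ 2 = sourcePotential b M x + targetPotential b M y + dualityGap b M x y := by
  obtain ⟨w, rfl⟩ : ∃ w, y = w + b := ⟨y - b, by simp⟩
  have e : w + b - affineAction b M x = w - matrixAction M x := by
    unfold affineAction; abel
  have e2 : matrixAction M⁻¹ (matrixAction M x) = x := by
    rw [← matrixAction_mul, hM.inv_mul_self]; simp [matrixAction]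
  have e3 : inner ℝ (matrixAction M x) (matrixAction M⁻¹ w) = inner ℝ x w := by
    rw [← inner_matrixAction_comm hM.inv.1, e2]
  have e4 : ‖x - (w + b)‖ ^ 2 = ‖x‖ ^ 2 - 2 * (inner ℝ x w + inner ℝ x b) +
      (‖w‖ ^ 2 + 2 * inner ℝ w b + ‖b‖ ^ 2) := by
    rw [norm_sub_sq_real, norm_add_sq_real, inner_add_right]
  rw [e4, dualityGap, e, sourcePotential, targetPotential, add_sub_cancel_right, map_sub, e2,
    inner_sub_left, inner_sub_right, inner_sub_right, e3, real_inner_comm w x,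
    real_inner_comm x (matrixAction M x)]
  ring

/-- The potentials of two consecutive steps of an interpolation cancel, up to a constant. -/
lemma targetPotential_add_sourcePotential {C D : Matrix (Fin d) (Fin d) ℝ} {s : ℝ}
    (hD : D.IsHermitian) (h : (1 - s) • C⁻¹ + s • D = 1) (b z : EuclideanSpace ℝ (Fin d)) :
    (1 - s) * targetPotential (s • b) C z + s * sourcePotential (b - s • matrixAction D b) D z =
      (1 - s) * targetPotential (s • b) C (s • b) +
        s * sourcePotential (b - s • matrixAction D b) D (s • b) := by
  obtain ⟨w, rfl⟩ : ∃ w, z = w + s • b := ⟨z - s • b, by simp⟩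
  -- This cancels the terms quadratic in `w`. The linear ones cancel because the second map sends `s
  -- • b` to `b`.
  have e : (1 - s) * inner ℝ w (matrixAction C⁻¹ w) + s * inner ℝ w (matrixAction D w) =
      ‖w‖ ^ 2 := by
    rw [← real_inner_self_eq_norm_sq, ← inner_smul_right, ← inner_smul_right, ← inner_add_right]
    congr 1
    have := congrArg (fun N ↦ matrixAction N w) h
    simpa [matrixAction] using this
  have e2 : inner ℝ b (matrixAction D w) = inner ℝ w (matrixAction D b) := by
    rw [← inner_matrixAction_comm hD, real_inner_comm]
  simp only [sourcePotential, targetPotential, add_sub_cancel_right, sub_self, map_add, map_smul,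
    map_zero, inner_add_left, inner_add_right, inner_sub_right, inner_smul_left, inner_smul_right,
    norm_add_sq_real, norm_zero, inner_zero_left, RCLike.conj_to_real, e2]
  linear_combination -e

end AffineMaps

/-! ### Integrated duality and optimality of affine maps. -/

noncomputable section Pushforward

variable {d : ℕ}

lemma MeasureTheory.MemLp.affineAction_comp {Ω : Type*} [MeasurableSpace Ω] {P : Measure Ω}
    [IsFiniteMeasure P] {X : Ω → EuclideanSpace ℝ (Fin d)} (hX : MemLp X 2 P)
    (b : EuclideanSpace ℝ (Fin d)) (M : Matrix (Fin d) (Fin d) ℝ) :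
    MemLp (fun ω ↦ affineAction b M (X ω)) 2 P :=
  (memLp_const b).add ((matrixAction M).comp_memLp' hX)

lemma MeasureTheory.MemLp.integrable_inner_of_two {Ω : Type*} [MeasurableSpace Ω] {P : Measure Ω}
    {X Y : Ω → EuclideanSpace ℝ (Fin d)} (hX : MemLp X 2 P) (hY : MemLp Y 2 P) :
    Integrable (fun ω ↦ (inner ℝ (X ω) (Y ω) : ℝ)) P := by
  refine (hX.norm.integrable_sq.add hY.norm.integrable_sq).mono' (hX.1.inner hY.1)
    (.of_forall fun ω ↦ (norm_inner_le_norm _ _).trans ?_)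
  simp only [Pi.add_apply]
  nlinarith [sq_nonneg (‖X ω‖ - ‖Y ω‖), sq_nonneg (‖X ω‖ + ‖Y ω‖)]

lemma integrable_sourcePotential (μ : P2 d) (b : EuclideanSpace ℝ (Fin d))
    (M : Matrix (Fin d) (Fin d) ℝ) : Integrable (sourcePotential b M) μ.1 := by
  have h := μ.memLp
  exact (h.norm.integrable_sq.sub (h.integrable_inner_of_two ((matrixAction M).comp_memLp' h))).sub
    ((h.integrable_inner_of_two (memLp_const b)).const_mul 2)

lemma integrable_targetPotential (μ : P2 d) (b : EuclideanSpace ℝ (Fin d))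
    (M : Matrix (Fin d) (Fin d) ℝ) : Integrable (targetPotential b M) μ.1 := by
  have h : MemLp (fun y ↦ y - b) 2 μ.1 := μ.memLp.sub (memLp_const b)
  exact ((h.norm.integrable_sq.sub
    (h.integrable_inner_of_two ((matrixAction M⁻¹).comp_memLp' h))).add
    ((h.integrable_inner_of_two (memLp_const b)).const_mul 2)).add (integrable_const _)

section

variable {μ ν : P2 d} {π : Measure (EuclideanSpace ℝ (Fin d) × EuclideanSpace ℝ (Fin d))}

lemma couplings.memLp_sub_affineAction (h : π ∈ couplings μ.1 ν.1)
    (b : EuclideanSpace ℝ (Fin d)) (M : Matrix (Fin d) (Fin d) ℝ) :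
    MemLp (fun z : EuclideanSpace ℝ (Fin d) × EuclideanSpace ℝ (Fin d) ↦
      z.2 - affineAction b M z.1) 2 π := by
  have := couplings.isProbabilityMeasure h
  exact (couplings.memLp_snd h).sub ((couplings.memLp_fst h).affineAction_comp b M)

lemma couplings.integrable_dualityGap (h : π ∈ couplings μ.1 ν.1)
    (b : EuclideanSpace ℝ (Fin d)) (M : Matrix (Fin d) (Fin d) ℝ) :
    Integrable (fun z ↦ dualityGap b M z.1 z.2) π := by
  have h1 := couplings.memLp_sub_affineAction h b M
  exact h1.integrable_inner_of_two ((matrixAction M⁻¹).comp_memLp' h1)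

/-- The potential terms see only the marginals, so among couplings of `μ` and `ν` only the gap term
varies. -/
lemma couplings.integral_norm_sub_sq (h : π ∈ couplings μ.1 ν.1) {M : Matrix (Fin d) (Fin d) ℝ}
    (hM : M.PosDef) (b : EuclideanSpace ℝ (Fin d)) :
    ∫ z, ‖z.1 - z.2‖ ^ 2 ∂π = ∫ x, sourcePotential b M x ∂μ.1 + ∫ y, targetPotential b M y ∂ν.1 +
      ∫ z, dualityGap b M z.1 z.2 ∂π := by
  have h1 := couplings.measurePreserving_fst h
  have h2 := couplings.measurePreserving_snd h
  have i1 : Integrable (fun z ↦ sourcePotential b M z.1) π :=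
    h1.integrable_comp_of_integrable (integrable_sourcePotential μ b M)
  have i2 : Integrable (fun z ↦ targetPotential b M z.2) π :=
    h2.integrable_comp_of_integrable (integrable_targetPotential ν b M)
  have e1 : ∫ x, sourcePotential b M x ∂μ.1 = ∫ z, sourcePotential b M z.1 ∂π := by
    rw [← h1.map_eq, integral_map measurable_fst.aemeasurable]
    rw [h1.map_eq]
    exact (integrable_sourcePotential μ b M).1
  have e2 : ∫ x, targetPotential b M x ∂ν.1 = ∫ z, targetPotential b M z.2 ∂π := by
    rw [← h2.map_eq, integral_map measurable_snd.aemeasurable]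
    rw [h2.map_eq]
    exact (integrable_targetPotential ν b M).1
  have i12 : Integrable (fun z ↦ sourcePotential b M z.1 + targetPotential b M z.2) π := i1.add i2
  rw [e1, e2, ← integral_add i1 i2,
    ← integral_add i12 (couplings.integrable_dualityGap h b M)]
  exact integral_congr_ae (.of_forall fun z ↦ norm_sub_sq_eq_potentials hM b z.1 z.2)

end

/-- The image of a measure under the affine map `x ↦ b + M x`. -/
def P2.affineMap (μ : P2 d) (b : EuclideanSpace ℝ (Fin d)) (M : Matrix (Fin d) (Fin d) ℝ) : P2 d :=
  ⟨μ.1.map (affineAction b M),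
    Measure.isProbabilityMeasure_map (measurable_affineAction b M).aemeasurable, by
      rw [memLp_map_measure_iff (by fun_prop) (by fun_prop)]
      exact μ.memLp.affineAction_comp b M⟩

lemma P2.affineMap_affineMap (μ : P2 d) (b c : EuclideanSpace ℝ (Fin d))
    (M N : Matrix (Fin d) (Fin d) ℝ) :
    (μ.affineMap b M).affineMap c N = μ.affineMap (c + matrixAction N b) (N * M) := by
  apply Subtype.ext
  simp only [P2.affineMap]
  rw [Measure.map_map (by fun_prop) (by fun_prop)]
  congr 1
  funext x
  simp only [Function.comp, affineAction, map_add, matrixAction_mul, add_assoc]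

lemma P2.affineMap_zero_one (μ : P2 d) : μ.affineMap 0 1 = μ := by
  apply Subtype.ext
  have : affineAction (0 : EuclideanSpace ℝ (Fin d)) 1 = id := by
    funext x; simp [affineAction, matrixAction]
  simp [P2.affineMap, this]

lemma integral_affineMap_norm_sq (μ : P2 d) (b : EuclideanSpace ℝ (Fin d))
    (M : Matrix (Fin d) (Fin d) ℝ)
    {f : EuclideanSpace ℝ (Fin d) → EuclideanSpace ℝ (Fin d)} (hf : Continuous f) :
    ∫ x, ‖f x‖ ^ 2 ∂(μ.affineMap b M).1 = ∫ x, ‖f (affineAction b M x)‖ ^ 2 ∂μ.1 :=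
  integral_map (by fun_prop) (Continuous.aestronglyMeasurable (by fun_prop))

lemma graph_mem_couplings (μ : P2 d) (b : EuclideanSpace ℝ (Fin d))
    (M : Matrix (Fin d) (Fin d) ℝ) :
    μ.1.map (fun x ↦ (x, affineAction b M x)) ∈ couplings μ.1 (μ.affineMap b M).1 := by
  constructor
  · rw [Measure.fst, Measure.map_map (by fun_prop) (by fun_prop)]
    exact Measure.map_id
  · rw [Measure.snd, Measure.map_map (by fun_prop) (by fun_prop)]
    rfl

lemma integral_norm_sub_affineAction_sq {M : Matrix (Fin d) (Fin d) ℝ} (hM : M.PosDef)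
    (μ : P2 d) (b : EuclideanSpace ℝ (Fin d)) :
    ∫ x, ‖x - affineAction b M x‖ ^ 2 ∂μ.1 = ∫ x, sourcePotential b M x ∂μ.1 +
      ∫ y, targetPotential b M y ∂(μ.affineMap b M).1 := by
  have h := graph_mem_couplings μ b M
  have h1 := couplings.integral_norm_sub_sq h hM b
  rw [integral_map (by fun_prop) (Continuous.aestronglyMeasurable (by fun_prop)),
    integral_map (by fun_prop) (couplings.integrable_dualityGap h b M).1] at h1
  simpa only [dualityGap_affineAction, integral_zero, add_zero] using h1

/-- Affine maps with positive definite linear part are optimal. -/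
lemma W2_affineMap_sq {M : Matrix (Fin d) (Fin d) ℝ} (hM : M.PosDef)
    (μ : P2 d) (b : EuclideanSpace ℝ (Fin d)) :
    W2 μ (μ.affineMap b M) ^ 2 = ∫ x, ‖x - affineAction b M x‖ ^ 2 ∂μ.1 := by
  apply le_antisymm
  · refine (W2_sq_le (graph_mem_couplings μ b M)).trans_eq ?_
    rw [integral_map (by fun_prop) (Continuous.aestronglyMeasurable (by fun_prop))]
  · refine le_of_forall_pos_le_add fun ε hε ↦ ?_
    obtain ⟨π, hπ, hlt⟩ := exists_coupling_lt μ (μ.affineMap b M) hε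
    rw [integral_norm_sub_affineAction_sq hM]
    rw [couplings.integral_norm_sub_sq hπ hM b] at hlt
    have : 0 ≤ ∫ z, dualityGap b M z.1 z.2 ∂π :=
      integral_nonneg fun z ↦ dualityGap_nonneg hM _ _ _
    linarith

end Pushforward

/-! ### Displacement interpolation and uniqueness of geodesics. -/

noncomputable section Interpolation

variable {d : ℕ}

lemma Matrix.PosDef.convexCombination {M N : Matrix (Fin d) (Fin d) ℝ} (hM : M.PosDef)
    (hN : N.PosDef) {s : ℝ} (hs0 : 0 ≤ s) (hs1 : s ≤ 1) : ((1 - s) • M + s • N).PosDef := by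
  rcases hs0.eq_or_lt with rfl | h0
  · simpa using hM
  · exact (hN.smul h0).posSemidef_add (hM.posSemidef.smul (sub_nonneg.2 hs1))

/-- The linear interpolation between the identity and `M`. -/
def interpolate (M : Matrix (Fin d) (Fin d) ℝ) (s : ℝ) : Matrix (Fin d) (Fin d) ℝ :=
  (1 - s) • 1 + s • M

variable {M : Matrix (Fin d) (Fin d) ℝ}

lemma Matrix.PosDef.interpolate (hM : M.PosDef) {s : ℝ} (hs0 : 0 ≤ s) (hs1 : s ≤ 1) :
    (interpolate M s).PosDef :=
  Matrix.PosDef.one.convexCombination hM hs0 hs1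

lemma interpolate_zero : interpolate M 0 = 1 := by simp [interpolate]

lemma interpolate_one : interpolate M 1 = M := by simp [interpolate]

lemma affineAction_interpolate (b : EuclideanSpace ℝ (Fin d)) (s : ℝ)
    (x : EuclideanSpace ℝ (Fin d)) :
    affineAction (s • b) (interpolate M s) x = (1 - s) • x + s • affineAction b M x := by
  simp only [affineAction, interpolate, matrixAction, map_add, map_smul, map_one,
    add_apply, smul_apply, one_apply_eq_self, smul_add]
  abel

/-- A product of positive definite matrices need not be symmetric, but this one is the inverse of
`(1 - s) • M⁻¹ + s • 1`. -/
lemma Matrix.PosDef.mul_interpolate_inv (hM : M.PosDef) {s : ℝ} (hs0 : 0 ≤ s) (hs1 : s ≤ 1) :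
    (M * (_root_.interpolate M s)⁻¹).PosDef := by
  have hN : ((1 - s) • M⁻¹ + s • (1 : Matrix (Fin d) (Fin d) ℝ)).PosDef :=
    hM.inv.convexCombination Matrix.PosDef.one hs0 hs1
  have h : _root_.interpolate M s = ((1 - s) • M⁻¹ + s • (1 : Matrix (Fin d) (Fin d) ℝ)) * M := by
    rw [add_mul, smul_mul_assoc, smul_mul_assoc, hM.inv_mul_self, one_mul, _root_.interpolate]
  rw [h, Matrix.mul_inv_rev, ← mul_assoc, hM.mul_inv_self, one_mul]
  exact hN.inv

/-- The product is the convex combination, with weights `1 - t` and `t`, of `(interpolate M s)⁻¹`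
and `M * (interpolate M s)⁻¹`. -/
lemma Matrix.PosDef.interpolate_mul_interpolate_inv (hM : M.PosDef) {s t : ℝ} (hs0 : 0 ≤ s)
    (hs1 : s ≤ 1) (ht0 : 0 ≤ t) (ht1 : t ≤ 1) :
    (_root_.interpolate M t * (_root_.interpolate M s)⁻¹).PosDef := by
  have := (hM.interpolate hs0 hs1).inv.convexCombination (hM.mul_interpolate_inv hs0 hs1) ht0 ht1
  convert this using 1
  rw [_root_.interpolate, add_mul, smul_mul_assoc, smul_mul_assoc, one_mul]

/-- The displacement interpolation between `μ` and its image under `x ↦ b + M x`. -/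
def displacement (μ : P2 d) (b : EuclideanSpace ℝ (Fin d)) (M : Matrix (Fin d) (Fin d) ℝ)
    (s : ℝ) : P2 d :=
  μ.affineMap (s • b) (interpolate M s)

lemma displacement_zero (μ : P2 d) (b : EuclideanSpace ℝ (Fin d)) :
    displacement μ b M 0 = μ := by
  rw [displacement, zero_smul, interpolate_zero, P2.affineMap_zero_one]

lemma displacement_one (μ : P2 d) (b : EuclideanSpace ℝ (Fin d)) :
    displacement μ b M 1 = μ.affineMap b M := by
  rw [displacement, one_smul, interpolate_one]

lemma displacement_eq_affineMap (hM : M.PosDef) (μ : P2 d) (b : EuclideanSpace ℝ (Fin d))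
    {s : ℝ} (hs0 : 0 ≤ s) (hs1 : s ≤ 1) (t : ℝ) :
    (displacement μ b M s).affineMap
      (t • b - s • matrixAction (interpolate M t * (interpolate M s)⁻¹) b)
      (interpolate M t * (interpolate M s)⁻¹) = displacement μ b M t := by
  rw [displacement, P2.affineMap_affineMap, mul_assoc, (hM.interpolate hs0 hs1).inv_mul_self,
    mul_one, map_smul, sub_add_cancel, displacement]

/-- The map from time `s` to time `t` is again affine with positive definite linear part, hence
optimal, and it moves each particle by `t - s` times its total displacement. -/
lemma W2_displacement (hM : M.PosDef) (μ : P2 d) (b : EuclideanSpace ℝ (Fin d))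
    {s t : ℝ} (hs0 : 0 ≤ s) (hs1 : s ≤ 1) (ht0 : 0 ≤ t) (ht1 : t ≤ 1) :
    W2 (displacement μ b M s) (displacement μ b M t) = |s - t| * W2 μ (μ.affineMap b M) := by
  rw [← sq_eq_sq₀ (W2_nonneg _ _) (mul_nonneg (abs_nonneg _) (W2_nonneg _ _)), mul_pow, sq_abs,
    W2_affineMap_sq hM, ← displacement_eq_affineMap hM μ b hs0 hs1 t,
    W2_affineMap_sq (hM.interpolate_mul_interpolate_inv hs0 hs1 ht0 ht1), displacement,
    integral_affineMap_norm_sq _ _ _ (by fun_prop), ← integral_const_mul]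
  refine integral_congr_ae (.of_forall fun x ↦ ?_)
  have e : affineAction (t • b - s • matrixAction (interpolate M t * (interpolate M s)⁻¹) b)
      (interpolate M t * (interpolate M s)⁻¹) (affineAction (s • b) (interpolate M s) x) =
      affineAction (t • b) (interpolate M t) x := by
    simp only [affineAction, map_add, map_smul]
    rw [← matrixAction_mul, mul_assoc, (hM.interpolate hs0 hs1).inv_mul_self, mul_one]
    abel
  have e2 : affineAction (s • b) (interpolate M s) x - affineAction (t • b) (interpolate M t) x =
      (t - s) • (x - affineAction b M x) := by
    rw [affineAction_interpolate, affineAction_interpolate]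
    module
  simp only [e, e2, norm_smul, mul_pow, Real.norm_eq_abs, sq_abs]
  ring

lemma eq_displacement_of_W2_eq (hM : M.PosDef) (μ ρ : P2 d) (b : EuclideanSpace ℝ (Fin d))
    {s : ℝ} (hs0 : 0 < s) (hs1 : s < 1)
    (h1 : W2 μ ρ = s * W2 μ (μ.affineMap b M))
    (h2 : W2 ρ (μ.affineMap b M) = (1 - s) * W2 μ (μ.affineMap b M)) :
    ρ = displacement μ b M s := by
  set ν := μ.affineMap b M with hν
  set C := interpolate M s with hC_def
  have hC : C.PosDef := hM.interpolate hs0.le hs1.le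
  set D := M * C⁻¹ with hD_def
  have hD : D.PosDef := hM.mul_interpolate_inv hs0.le hs1.le
  have hCD : (1 - s) • C⁻¹ + s • D = 1 := by
    calc (1 - s) • C⁻¹ + s • D = ((1 - s) • 1 + s • M) * C⁻¹ := by
          rw [add_mul, smul_mul_assoc, smul_mul_assoc, one_mul]
      _ = 1 := hC.mul_inv_self
  set c := b - s • matrixAction D b with hc_def
  have hν2 : (displacement μ b M s).affineMap c D = ν := by
    have := displacement_eq_affineMap hM μ b hs0.le hs1.le 1
    rwa [interpolate_one, one_smul, displacement_one] at this
  -- The contribution of the intermediate measure to the weighted cost does not depend on that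
  -- measure, so `ρ` can be compared with the displacement interpolant.
  obtain ⟨k, hk⟩ : ∃ k : ℝ, ∀ σ : P2 d, (1 - s) * ∫ y, targetPotential (s • b) C y ∂σ.1 +
      s * ∫ x, sourcePotential c D x ∂σ.1 = k := by
    refine ⟨(1 - s) * targetPotential (s • b) C (s • b) + s * sourcePotential c D (s • b),
      fun σ ↦ ?_⟩
    rw [← integral_const_mul, ← integral_const_mul, ← integral_add
      ((integrable_targetPotential _ _ _).const_mul _)
      ((integrable_sourcePotential _ _ _).const_mul _)]
    simp_rw [hc_def, targetPotential_add_sourcePotential hD.1 hCD]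
    simp
  have w1 : (s * W2 μ ν) ^ 2 = ∫ x, sourcePotential (s • b) C x ∂μ.1 +
      ∫ y, targetPotential (s • b) C y ∂(displacement μ b M s).1 := by
    have := W2_displacement hM μ b le_rfl zero_le_one hs0.le hs1.le
    rw [displacement_zero, zero_sub, abs_neg, abs_of_pos hs0] at this
    rw [← this, displacement, W2_affineMap_sq hC, integral_norm_sub_affineAction_sq hC]
  have w2 : ((1 - s) * W2 μ ν) ^ 2 = ∫ x, sourcePotential c D x ∂(displacement μ b M s).1 +
      ∫ y, targetPotential c D y ∂ν.1 := by
    have := W2_displacement hM μ b hs0.le hs1.le zero_le_one le_rfl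
    rw [displacement_one, abs_sub_comm, abs_of_pos (sub_pos.2 hs1)] at this
    rw [← this, ← hν, ← hν2, W2_affineMap_sq hD, integral_norm_sub_affineAction_sq hD]
  obtain ⟨a, ha, hle⟩ := hC.inv.exists_le_inner
  refine Subtype.ext (eq_map_of_forall_coupling (measurable_affineAction _ _) fun ε hε ↦ ?_)
  -- The weights sum to one, so the total error is this number; dividing by `1 - s` and by the
  -- coercivity constant `a` of `C⁻¹` leaves `ε`.
  have hδ : 0 < (1 - s) * (a * ε) := mul_pos (sub_pos.2 hs1) (mul_pos ha hε)
  obtain ⟨π, hπ, hπlt⟩ := exists_coupling_lt μ ρ hδ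
  obtain ⟨π', hπ', hπ'lt⟩ := exists_coupling_lt ρ ν hδ
  have hint := (couplings.memLp_sub_affineAction hπ (s • b) C).norm.integrable_sq
  refine ⟨π, hπ, hint, ?_⟩
  rw [h1, couplings.integral_norm_sub_sq hπ hC (s • b), w1] at hπlt
  rw [h2, couplings.integral_norm_sub_sq hπ' hD c, w2] at hπ'lt
  have g2 : 0 ≤ ∫ z, dualityGap c D z.1 z.2 ∂π' :=
    integral_nonneg fun z ↦ dualityGap_nonneg hD _ _ _
  have g1 : a * ∫ z, ‖z.2 - affineAction (s • b) C z.1‖ ^ 2 ∂π ≤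
      ∫ z, dualityGap (s • b) C z.1 z.2 ∂π := by
    rw [← integral_const_mul]
    exact integral_mono (hint.const_mul a) (couplings.integrable_dualityGap hπ _ _)
      fun z ↦ hle _
  have k1 := hk ρ
  have k2 := hk (displacement μ b M s)
  have s1 : 0 < 1 - s := sub_pos.2 hs1
  have m1 := mul_lt_mul_of_pos_left hπlt s1
  have m2 := mul_lt_mul_of_pos_left hπ'lt hs0
  have m3 := mul_nonneg hs0.le g2
  -- Add `m1` and `m2`: by `k1` and `k2` all potentials cancel, and the second gap is dropped by
  -- `m3`.
  have m4 : (1 - s) * ∫ z, dualityGap (s • b) C z.1 z.2 ∂π < (1 - s) * (a * ε) := by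
    nlinarith
  have m5 := lt_of_mul_lt_mul_left m4 s1.le
  exact le_of_mul_le_mul_left (g1.trans m5.le) ha

/-- The geodesics from `μ` to its image under an affine map with positive definite linear part
are the displacement interpolations. -/
theorem isGeodesic_affineMap_iff (hM : M.PosDef) (μ : P2 d) (b : EuclideanSpace ℝ (Fin d))
    (γ : unitInterval → P2 d) :
    IsGeodesic W2 μ (μ.affineMap b M) γ ↔ ∀ t : unitInterval, γ t = displacement μ b M t := by
  constructor
  · rintro ⟨h0, h1, h⟩ t
    rcases t.2.1.eq_or_lt with ht0 | ht0
    · have : t = 0 := Subtype.ext ht0.symm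
      rw [this, h0, Set.Icc.coe_zero, displacement_zero]
    rcases t.2.2.eq_or_lt with ht1 | ht1
    · have : t = 1 := Subtype.ext ht1
      rw [this, h1, Set.Icc.coe_one, displacement_one]
    refine eq_displacement_of_W2_eq hM μ (γ t) b ht0 ht1 ?_ ?_
    · have := h 0 t
      rwa [h0, Set.Icc.coe_zero, zero_sub, abs_neg, abs_of_pos ht0] at this
    · have := h t 1
      rwa [h1, Set.Icc.coe_one, abs_sub_comm, abs_of_pos (sub_pos.2 ht1)] at this
  · intro h
    refine ⟨?_, ?_, fun s t ↦ ?_⟩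
    · rw [h, Set.Icc.coe_zero, displacement_zero]
    · rw [h, Set.Icc.coe_one, displacement_one]
    · rw [h, h, W2_displacement hM μ b s.2.1 s.2.2 t.2.1 t.2.2]

end Interpolation

/-! ### Gaussian measures under affine maps, and the three claims. -/

noncomputable section Gaussian

variable {d : ℕ}

lemma charFun_map_affineAction (μ : Measure (EuclideanSpace ℝ (Fin d)))
    {M : Matrix (Fin d) (Fin d) ℝ} (hM : M.IsHermitian) (b ξ : EuclideanSpace ℝ (Fin d)) :
    charFun (μ.map (affineAction b M)) ξ =
      Complex.exp (inner ℝ b ξ * Complex.I) * charFun μ (matrixAction M ξ) := by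
  rw [charFun_apply, charFun_apply, integral_map (by fun_prop)
    (Measurable.aestronglyMeasurable (by fun_prop)), ← integral_const_mul]
  refine integral_congr_ae (.of_forall fun x ↦ ?_)
  simp only
  rw [affineAction, inner_add_left, inner_matrixAction_comm hM, ← Complex.exp_add]
  push_cast
  ring_nf

lemma gaussianP2_affineMap {S M : Matrix (Fin d) (Fin d) ℝ} (hS : S.PosSemidef)
    (hM : M.IsHermitian) (m b : EuclideanSpace ℝ (Fin d)) :
    (gaussianP2 m S).affineMap b M = gaussianP2 (affineAction b M m) (M * S * M) := by
  have hMS : (M * S * M).PosSemidef := by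
    simpa only [hM.eq] using hS.conjTranspose_mul_mul_same M
  refine Subtype.ext ?_
  have := ((gaussianP2 m S).affineMap b M).2.1
  have := (gaussianP2 (affineAction b M m) (M * S * M)).2.1
  refine Measure.ext_of_charFun (funext fun ξ ↦ ?_)
  change charFun ((multivariateGaussian m S).map (affineAction b M)) ξ =
    charFun (multivariateGaussian (affineAction b M m) (M * S * M)) ξ
  rw [charFun_map_affineAction _ hM, charFun_multivariateGaussian hS,
    charFun_multivariateGaussian hMS, ← Complex.exp_add, ← Matrix.inner_toEuclideanCLM,
    ← Matrix.inner_toEuclideanCLM]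
  have e : (inner ℝ ξ (Matrix.toEuclideanCLM (𝕜 := ℝ) (M * S * M) ξ) : ℝ) =
      inner ℝ (matrixAction M ξ) (Matrix.toEuclideanCLM (𝕜 := ℝ) S (matrixAction M ξ)) := by
    rw [inner_matrixAction_comm hM]
    change inner ℝ ξ (matrixAction (M * S * M) ξ) = _
    rw [matrixAction_mul, matrixAction_mul]
  rw [e, affineAction, inner_add_right, inner_matrixAction_comm hM, real_inner_comm ξ b]
  push_cast
  ring_nf

lemma Matrix.PosDef.mul_mul_posDef {P X : Matrix (Fin d) (Fin d) ℝ} (hP : P.PosDef)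
    (hX : X.PosDef) : (P * X * P).PosDef := by
  have := (Matrix.IsUnit.posDef_star_left_conjugate_iff (x := X) hP.isUnit).2 hX
  rwa [show star P = P from hP.1] at this

open scoped MatrixOrder in
/-- The linear part of the optimal map between centered nondegenerate Gaussian measures. -/
lemma exists_posDef_mul_mul_eq {A B : Matrix (Fin d) (Fin d) ℝ} (hA : A.PosDef) (hB : B.PosDef) :
    ∃ C : Matrix (Fin d) (Fin d) ℝ, C.PosDef ∧ C * A * C = B := by
  set R := CFC.sqrt A
  have hR : R.PosDef := hA.sqrt
  have hRR : R * R = A := CFC.sqrt_mul_sqrt_self A hA.posSemidef.nonneg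
  have hY : (R * B * R).PosDef := hR.mul_mul_posDef hB
  set Q := CFC.sqrt (R * B * R)
  have hQQ : Q * Q = R * B * R := CFC.sqrt_mul_sqrt_self _ hY.posSemidef.nonneg
  -- Conjugating by `R` turns `C * A * C = B` into `(R * C * R) ^ 2 = R * B * R`, so `R * C * R` is
  -- taken to be the square root `Q`.
  refine ⟨R⁻¹ * Q * R⁻¹, hR.inv.mul_mul_posDef hY.sqrt, ?_⟩
  calc R⁻¹ * Q * R⁻¹ * A * (R⁻¹ * Q * R⁻¹)
      = R⁻¹ * Q * (R⁻¹ * R) * (R * R⁻¹) * Q * R⁻¹ := by rw [← hRR]; simp only [mul_assoc]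
    _ = R⁻¹ * (Q * Q) * R⁻¹ := by
      rw [hR.inv_mul_self, hR.mul_inv_self, mul_one, mul_one]; simp only [mul_assoc]
    _ = (R⁻¹ * R) * B * (R * R⁻¹) := by rw [hQQ]; simp only [mul_assoc]
    _ = B := by rw [hR.inv_mul_self, hR.mul_inv_self, one_mul, mul_one]

lemma displacement_gaussianP2 {S M : Matrix (Fin d) (Fin d) ℝ} (hS : S.PosSemidef)
    (hM : M.PosDef) (m b : EuclideanSpace ℝ (Fin d)) {s : ℝ} (hs0 : 0 ≤ s) (hs1 : s ≤ 1) :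
    displacement (gaussianP2 m S) b M s =
      gaussianP2 ((1 - s) • m + s • affineAction b M m)
        (interpolate M s * S * interpolate M s) := by
  rw [displacement, gaussianP2_affineMap hS (hM.interpolate hs0 hs1).1, affineAction_interpolate]

/-- Every geodesic is a displacement interpolation, so its covariance is `A` conjugated by an
invertible symmetric matrix and stays positive definite. -/
lemma geodesicallyConvex_nondegenerateGaussians :
    GeodesicallyConvex (W2 (d := d)) (nondegenerateGaussians d) := by
  rintro _ ⟨m, A, hA, rfl⟩ _ ⟨n, B, hB, rfl⟩
  obtain ⟨C, hC, hCAC⟩ := exists_posDef_mul_mul_eq hA hB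
  have hmap : gaussianP2 n B = (gaussianP2 m A).affineMap (n - matrixAction C m) C := by
    rw [gaussianP2_affineMap hA.posSemidef hC.1, hCAC, affineAction, sub_add_cancel]
  rw [hmap]
  refine ⟨⟨fun t ↦ displacement (gaussianP2 m A) (n - matrixAction C m) C t,
    (isGeodesic_affineMap_iff hC _ _ _).2 fun _ ↦ rfl⟩, fun γ hγ t ↦ ?_⟩
  rw [(isGeodesic_affineMap_iff hC _ _ _).1 hγ t,
    displacement_gaussianP2 hA.posSemidef hC _ _ t.2.1 t.2.2]
  exact ⟨_, _, (hC.interpolate t.2.1 t.2.2).mul_mul_posDef hA, rfl⟩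

lemma interpolate_smul_one (r s : ℝ) :
    interpolate (r • (1 : Matrix (Fin d) (Fin d) ℝ)) s = ((1 - s) + s * r) • 1 := by
  rw [interpolate, smul_smul, ← add_smul]

/-- Here the optimal linear part is the scalar `√(δ / ε)`, so every interpolated covariance remains
a multiple of the identity. -/
lemma isGeodesic_isotropicGaussian_iff (m n : EuclideanSpace ℝ (Fin d)) {ε δ : ℝ} (hε : 0 < ε)
    (hδ : 0 < δ) (γ : unitInterval → P2 d) :
    IsGeodesic W2 (isotropicGaussian m ε) (isotropicGaussian n δ) γ ↔
      ∀ t : unitInterval, γ t = isotropicGaussian ((1 - (t : ℝ)) • m + (t : ℝ) • n)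
        (((1 - (t : ℝ)) + (t : ℝ) * Real.sqrt (δ / ε)) ^ 2 * ε) := by
  set r := Real.sqrt (δ / ε)
  have hr : 0 < r := Real.sqrt_pos.2 (div_pos hδ hε)
  have hrr : r * r * ε = δ := by
    rw [Real.mul_self_sqrt (div_pos hδ hε).le, div_mul_cancel₀ _ hε.ne']
  have hC : (r • (1 : Matrix (Fin d) (Fin d) ℝ)).PosDef := Matrix.PosDef.one.smul hr
  have hS : (ε • (1 : Matrix (Fin d) (Fin d) ℝ)).PosSemidef := Matrix.PosSemidef.one.smul hε.le
  set b := n - matrixAction (r • (1 : Matrix (Fin d) (Fin d) ℝ)) m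
  have hb : affineAction b (r • (1 : Matrix (Fin d) (Fin d) ℝ)) m = n := sub_add_cancel _ _
  have hmap : isotropicGaussian n δ =
      (isotropicGaussian m ε).affineMap b (r • (1 : Matrix (Fin d) (Fin d) ℝ)) := by
    rw [isotropicGaussian, isotropicGaussian, gaussianP2_affineMap hS hC.1, hb, ← hrr]
    congr 1
    simp only [smul_mul_assoc, mul_smul_comm, one_mul, smul_smul]
    ring_nf
  rw [hmap, isGeodesic_affineMap_iff hC]
  refine forall_congr' fun t ↦ ?_
  rw [isotropicGaussian, isotropicGaussian, displacement_gaussianP2 hS hC _ _ t.2.1 t.2.2, hb,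
    interpolate_smul_one]
  have : ((1 - (t : ℝ) + t * r) • (1 : Matrix (Fin d) (Fin d) ℝ)) * (ε • 1) *
      ((1 - (t : ℝ) + t * r) • 1) = ((1 - (t : ℝ) + t * r) ^ 2 * ε) • 1 := by
    simp only [smul_mul_assoc, mul_smul_comm, one_mul, smul_smul]
    ring_nf
  rw [this]

lemma isotropicGaussians_subset : isotropicGaussians d ⊆ nondegenerateGaussians d := by
  rintro _ ⟨m, ε, hε, rfl⟩
  exact ⟨m, _, Matrix.PosDef.one.smul hε, rfl⟩

/-- A geodesic for `BW` is one for `W2` after forgetting nondegeneracy, so uniqueness in the larger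
space applies; conversely the explicit `W2` geodesic consists of nondegenerate Gaussians and lifts.
-/
lemma geodesicallyConvex_isotropicGaussians :
    GeodesicallyConvex (BW (d := d)) {μ : BuresWasserstein d | μ.1 ∈ isotropicGaussians d} := by
  rintro ⟨μ, hμ⟩ ⟨m, ε, hε, rfl⟩ ⟨ν, hν⟩ ⟨n, δ, hδ, rfl⟩
  have hmem (t : unitInterval) : isotropicGaussian ((1 - (t : ℝ)) • m + (t : ℝ) • n)
      (((1 - (t : ℝ)) + (t : ℝ) * Real.sqrt (δ / ε)) ^ 2 * ε) ∈ isotropicGaussians d := by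
    have hr : 0 < Real.sqrt (δ / ε) := Real.sqrt_pos.2 (div_pos hδ hε)
    have ht0 := t.2.1
    have ht1 := t.2.2
    have : 0 < (1 - (t : ℝ)) + (t : ℝ) * Real.sqrt (δ / ε) := by
      rcases ht0.eq_or_lt with h | h
      · rw [← h]; norm_num
      · have := mul_pos h hr
        linarith
    exact ⟨_, _, by positivity, rfl⟩
  constructor
  · obtain ⟨h0, h1, h⟩ := (isGeodesic_isotropicGaussian_iff m n hε hδ _).2 fun _ ↦ rfl
    exact ⟨fun t ↦ ⟨_, isotropicGaussians_subset (hmem t)⟩, Subtype.ext h0, Subtype.ext h1, h⟩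
  · rintro γ ⟨h0, h1, h⟩ t
    have hγ : IsGeodesic W2 (isotropicGaussian m ε) (isotropicGaussian n δ) fun t ↦ (γ t).1 :=
      ⟨congrArg Subtype.val h0, congrArg Subtype.val h1, h⟩
    have := (isGeodesic_isotropicGaussian_iff m n hε hδ _).1 hγ t
    change (γ t).1 ∈ isotropicGaussians d
    rw [this]
    exact hmem t

end Gaussian

theorem mainTheorem4 (d : ℕ) :
    -- isotropic Gaussians form a geodesically convex subset of the Bures–Wasserstein space
    (isotropicGaussians d ⊆ nondegenerateGaussians d ∧
      GeodesicallyConvex (BW (d := d)) {μ : BuresWasserstein d | μ.1 ∈ isotropicGaussians d}) ∧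
    -- the Bures–Wasserstein space is geodesically convex in the Wasserstein space
    GeodesicallyConvex (W2 (d := d)) (nondegenerateGaussians d) ∧
    -- the W₂ geodesic between two isotropic Gaussians
    (∀ (m_p m_q : EuclideanSpace ℝ (Fin d)) (ε_p ε_q : ℝ), 0 < ε_p → 0 < ε_q →
      ∀ γ : unitInterval → P2 d,
        IsGeodesic W2 (isotropicGaussian m_p ε_p) (isotropicGaussian m_q ε_q) γ ↔
          ∀ t : unitInterval, γ t = isotropicGaussian
            ((1 - (t : ℝ)) • m_p + (t : ℝ) • m_q)
            (((1 - (t : ℝ)) + (t : ℝ) * Real.sqrt (ε_q / ε_p)) ^ 2 * ε_p)) := by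
  exact ⟨⟨isotropicGaussians_subset, geodesicallyConvex_isotropicGaussians⟩,
    geodesicallyConvex_nondegenerateGaussians,
    fun m_p m_q _ _ hp hq γ ↦ isGeodesic_isotropicGaussian_iff m_p m_q hp hq γ⟩
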